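/- Conventions. All graphs are finite and simple, and $d(x)$ is the degree of $x$ in $G$. A graph is 2-connected if it has at least three vertices, is connected, and stays connected after the deletion of any single vertex. An outer-1-plane graph is a graph drawn in the plane so that all vertices lie on the boundary of the outer face and every edge is crossed at most once; a graph having such a drawing is outer-1-planar. Let $v_1,\dots,v_n$ be the vertices in the clockwise order in which they occur on the outer boundary. In such a drawing two edges cross exactly when their four ends are distinct and alternate along the boundary; so an outer-1-plane drawing is given by a cyclic order of the vertices for which every edge alternates with at most one other edge. Configurations. Each $G_i$ is a graph in which some vertices are solid, the others are hollow, and at most one hollow vertex is marked. We list the vertices as $0,1,2,\dots$ and write $ab$ for the edge joining $a$ and $b$. For $i\ge 6$ the picture of $G_i$ is the drawing with the vertices on the outer boundary in the order $0,1,2,\dots$. - $G_1$: edges $01,12,23$; solid $1,2$. - $G_2$: edges $01,02,12,13$; solid $0,1$. - $G_3$: edges $01,02,13,23$; solid $u=1$ and $v=2$; marked $3$. - $G_4$: edges $01,12,23,34,02,24$; solid $1,2,3$. - $G_5$: edges $01,12,02,23,34,25$; solid $1,2,3$. - For $6\le i\le 17$, $G_i$ is a path $0\,1\cdots(m-1)$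 together with some chords; the solid vertices are $1,\dots,m-2$: - $m=4$: $G_6$ has chords $02,13$, and the vertex $3$ is marked. - $m=5$: $G_7$ has chords $03,14$ and $G_{12}$ has chords $03,14,13$, and in both the vertex $4$ is marked; $G_8$ has chords $02,14$; $G_{13}$ has chords $02,14,24$. - $m=6$: $G_9$ has chords $03,25$; $G_{14}$ has chords $03,25,02$; $G_{16}$ has chords $03,25,02,35$; $G_{10}$ has chords $03,15$; $G_{15}$ has chords $03,15,13,35$. - $m=7$: $G_{11}$ has chords $04,26$; $G_{17}$ has chords $04,26,02,24,46$. $G$ contains $G_i$ if it has a (not necessarily induced) subgraph isomorphic to $G_i$ in which every vertex of $G$ corresponding to a solid (respectively hollow) vertex has degree in $G$ exactly (respectively at least) the number of edges incident with that vertex in $G_i$, and a vertex corresponding to the marked vertex has degree at most $7$ in $G$. $G[v_1,v_n]$ (the subgraph induced by all of $v_1,\dots,v_n$, that is, $G$ itself) properly contains $G_i$ if there is such a copy of $G_i$ in which neither $v_1$ nor $v_n$ corresponds to a solid or to the marked vertex. For a copy of $G_i$ consider the properties: - $\mathfrak D_1$: if $i=3$, then the graph obtained from $G$ by adding the edge between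 the vertices corresponding to $u$ and $v$ is still outer-1-planar; - $\mathfrak D_2$: if $6\le i\le 17$, then the picture of $G_i$ corresponds, up to inversion, to a partial drawing of $G$; that is, the vertices corresponding to $0,1,2,\dots$ occur on the outer boundary of $G$ in this cyclic order or in the reverse one. Theorem 2.3. Let $G$ be a 2-connected outer-1-plane graph and let $v_1,\dots,v_n$ ($n=|G|$) be its vertices in clockwise order on the outer boundary. (1) If $n=4$, then $G[v_1,v_4]$ properly contains $G_1$ or $G_2$, unless $v_1v_3$ and $v_2v_4$ are edges that cross each other and $v_1v_2,v_3v_4\in E(G)$. (2) If $n=5$, then $G[v_1,v_5]$ properly contains one of $G_1,G_2,G_3,G_4,G_6,G_8,G_{13}$, by a copy for which $\mathfrak D_1$ and $\mathfrak D_2$ hold, unless $v_1v_2,v_2v_3,v_3v_4,v_4v_5\in E(G)$ and $v_1v_4,v_2v_5\in E(G)$. (3) If $n\ge 6$, then $G[v_1,v_n]$ properly contains one of $G_1,\dots,G_{17}$, by a copy for which $\mathfrak D_1$ and $\mathfrak D_2$ hold. -/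

import Mathlib

/-- `G` is 2-connected: it has at least three vertices, is connected, and stays connected when
any single vertex is deleted. -/
def TwoConnected {V : Type*} (G : SimpleGraph V) : Prop :=
  3 ≤ Nat.card V ∧ G.Connected ∧ ∀ x : V, (G.induce {x}ᶜ).Connected

/-- The three positions `a, b, c` are distinct and occur in this cyclic order on the boundary,
i.e. going once around from `a` one meets `b` before `c`. -/
def InCyclicOrder {n : ℕ} (a b c : Fin n) : Prop :=
  (a < b ∧ b < c) ∨ (b < c ∧ c < a) ∨ (c < a ∧ a < b)

instance {n : ℕ} (a b c : Fin n) : Decidable (InCyclicOrder a b c) :=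
  inferInstanceAs (Decidable ((a < b ∧ b < c) ∨ (b < c ∧ c < a) ∨ (c < a ∧ a < b)))

/-- Let the vertices be placed in the clockwise order `v 0, v 1, …, v (n - 1)` on the boundary of
the outer face, all edges being drawn inside. The edges `ab` and `cd` cross when their four end-vertices
are distinct and alternate around the boundary: one of `c, d` lies strictly between `a` and `b`,
the other one strictly between `b` and `a`. -/
def EdgesCross {V : Type*} {n : ℕ} (v : Fin n ≃ V) (a b c d : V) : Prop :=
  (InCyclicOrder (v.symm a) (v.symm c) (v.symm b) ∧
    InCyclicOrder (v.symm b) (v.symm d) (v.symm a)) ∨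
  (InCyclicOrder (v.symm a) (v.symm d) (v.symm b) ∧
    InCyclicOrder (v.symm b) (v.symm c) (v.symm a))

/-- The drawing of `G` with all vertices on the boundary of the outer face, in the clockwise order
`v`, is an outer-1-plane graph: each edge is crossed by at most one other edge.

With all vertices on the outer face and at most one crossing per edge, the boundary order determines
which pairs of edges cross (exactly the alternating ones, once each), so that a drawing is given by
the boundary order. -/
def IsOuterOnePlane {V : Type*} {n : ℕ} (G : SimpleGraph V) (v : Fin n ≃ V) : Prop :=
  ∀ a b c d c' d' : V, G.Adj a b → G.Adj c d → G.Adj c' d' →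
    EdgesCross v a b c d → EdgesCross v a b c' d' → s(c, d) = s(c', d')

/-- An abstract graph is outer-1-planar if it has an outer-1-plane drawing. -/
def OuterOnePlanar {V : Type*} (G : SimpleGraph V) : Prop :=
  ∃ (n : ℕ) (v : Fin n ≃ V), IsOuterOnePlane G v

/-- A picture of a local configuration: vertices `0, …, size - 1` (for `G₆, …, G₁₇` in the order in which the
picture shows them along the outer boundary); edges (each listed once); the set of solid vertices
(the other ones are hollow); and the set of marked hollow vertices. -/
structure Picture where
  size : ℕ
  edges : Finset (ℕ × ℕ)
  solid : Finset ℕ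
  marked : Finset ℕ

/-- The number of edges incident with the vertex `i` in the picture. -/
def Picture.degree (P : Picture) (i : ℕ) : ℕ :=
  (P.edges.filter (fun e => e.1 = i ∨ e.2 = i)).card

/-- The picture consisting of the path `0, 1, …, m - 1` and the edges in `E`, in which exactly the
inner vertices of the path are solid, without marked vertices. -/
def pathPicture (m : ℕ) (E : Finset (ℕ × ℕ)) : Picture where
  size := m
  edges := (Finset.range (m - 1)).image (fun i => (i, i + 1)) ∪ E
  solid := Finset.Ioo 0 (m - 1)
  marked := ∅

/-- The picture `P` with the vertex `i` marked. -/
def Picture.mark (P : Picture) (i : ℕ) : Picture :=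
  { P with marked := {i} }

/-- The seventeen pictures `G₁, …, G₁₇` (the value at other indices is irrelevant).

* `G₁`: two adjacent vertices of degree 2.
* `G₂`: a triangle with a vertex of degree 2 and a vertex of degree 3.
* `G₃`: a 4-cycle `x u y v` with `u, v` of degree 2 (`x, u, v, y = 0, 1, 2, 3`).
* `G₄`: two triangles sharing exactly one vertex, which has degree 4, each of them with
  a vertex of degree 2.
* `G₅`: a vertex `2` of degree 4 with two neighbours `1` and `3` of degree 2, where `0, 1, 2` is
  a triangle, the other neighbour `4` of `3` is not in it, and `5` is the fourth neighbour of `2`.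
* `G₆`, …, `G₁₇`: a path on the outer boundary with exactly one pair of crossing chords.

In `G₃, G₆, G₇, G₁₂` the last vertex `y` is marked. -/
def picture : ℕ → Picture
  | 1 => pathPicture 4 ∅
  | 2 => { size := 4, edges := {(0, 1), (0, 2), (1, 2), (1, 3)}, solid := {0, 1}, marked := ∅ }
  | 3 => { size := 4, edges := {(0, 1), (0, 2), (1, 3), (2, 3)}, solid := {1, 2}, marked := {3} }
  | 4 => pathPicture 5 {(0, 2), (2, 4)}
  | 5 => { size := 6, edges := {(0, 1), (1, 2), (0, 2), (2, 3), (3, 4), (2, 5)},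
           solid := {1, 2, 3}, marked := ∅ }
  | 6 => (pathPicture 4 {(0, 2), (1, 3)}).mark 3
  | 7 => (pathPicture 5 {(0, 3), (1, 4)}).mark 4
  | 8 => pathPicture 5 {(0, 2), (1, 4)}
  | 9 => pathPicture 6 {(0, 3), (2, 5)}
  | 10 => pathPicture 6 {(0, 3), (1, 5)}
  | 11 => pathPicture 7 {(0, 4), (2, 6)}
  | 12 => (pathPicture 5 {(0, 3), (1, 4), (1, 3)}).mark 4
  | 13 => pathPicture 5 {(0, 2), (1, 4), (2, 4)}
  | 14 => pathPicture 6 {(0, 3), (2, 5), (0, 2)}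
  | 15 => pathPicture 6 {(0, 3), (1, 5), (1, 3), (3, 5)}
  | 16 => pathPicture 6 {(0, 3), (2, 5), (0, 2), (3, 5)}
  | 17 => pathPicture 7 {(0, 4), (2, 6), (0, 2), (2, 4), (4, 6)}
  | _ => pathPicture 0 ∅

/-- `G` contains the picture `P`, with the vertex `i` of `P` (for `i < P.size`) at the vertex `f i`
of `G`: the picture is a subgraph of `G`; solid (hollow) vertices have in `G` exactly (at least) the
degree that they have in the picture; and marked vertices have degree at most 7 in `G`. -/
structure ContainsAt {V : Type*} [Fintype V] (G : SimpleGraph V) [DecidableRel G.Adj]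
    (P : Picture) (f : ℕ → V) : Prop where
  injOn : Set.InjOn f (Set.Iio P.size)
  adj : ∀ e ∈ P.edges, G.Adj (f e.1) (f e.2)
  solid : ∀ i ∈ P.solid, G.degree (f i) = P.degree i
  hollow : ∀ i < P.size, i ∉ P.solid → P.degree i ≤ G.degree (f i)
  marked : ∀ i ∈ P.marked, G.degree (f i) ≤ 7

/-- `G = G[s, t]` properly contains `P` at `f`, where `s` and `t` are the first and the last vertex
of the boundary sequence: neither of them is at a solid or at a marked vertex of `P`. -/
def ProperlyContainsAt {V : Type*} [Fintype V] (G : SimpleGraph V) [DecidableRel G.Adj]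
    (s t : V) (P : Picture) (f : ℕ → V) : Prop :=
  ContainsAt G P f ∧ ∀ i ∈ P.solid ∪ P.marked, f i ≠ s ∧ f i ≠ t

/-- Property `𝔇₁` of the copy at `f` of the `i`-th picture: if it is a copy of `G₃`, then adding an
edge between the vertices `u` and `v` of that copy keeps `G` outer-1-planar. -/
def PropertyD1 {V : Type*} (G : SimpleGraph V) (i : ℕ) (f : ℕ → V) : Prop :=
  i = 3 → OuterOnePlanar (G ⊔ SimpleGraph.edge (f 1) (f 2))

/-- Property `𝔇₂` of the copy at `f` of the `i`-th picture: if `6 ≤ i ≤ 17`, then the picture is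
a partial drawing of `G`, up to inversion. That is, the vertices of the copy lie on the outer
boundary of `G` in the cyclic order that the picture shows, or all in the reverse order
(so that the edges of the copy cross in `G` exactly as they do in the picture). -/
def PropertyD2 {V : Type*} {n : ℕ} (v : Fin n ≃ V) (i : ℕ) (f : ℕ → V) : Prop :=
  6 ≤ i → i ≤ 17 →
    (∀ a b c : ℕ, a < b → b < c → c < (picture i).size →
      InCyclicOrder (v.symm (f a)) (v.symm (f b)) (v.symm (f c))) ∨
    (∀ a b c : ℕ, a < b → b < c → c < (picture i).size →
      InCyclicOrder (v.symm (f c)) (v.symm (f b)) (v.symm (f a)))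

/-! Vertices are replaced by their positions on the boundary, and a stronger statement about
intervals is proved by induction on the length: in a closed interval (no edge joins its inside to
its outside) of length at least 3, a configuration occurs with its solid and marked vertices
strictly inside, unless the interval is exceptional (`found_or_exceptional`). The whole boundary is
closed, and exceptional intervals have length 3 or 4.

For the inductive step, suppose nothing is found. If the ends `a`, `b` have chords `ay` and `zb`
that cross, these can be crossed by no further edge, so `[a,z]`, `[z,y]`, `[y,b]` are closed
(`closedInterval_of_crosses`). Otherwise some inner vertex `u` splits the interval into two closed
ones (`exists_split`). By induction each part has length at most 2 or is exceptional. In both cases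
an end of a part has at most three neighbours in that part (`Slim`), so every division vertex has
degree at most 7. An exceptional part therefore yields `G₃`, `G₆`, `G₇` or `G₁₂`, marked at a
division vertex (`Exceptional.found`).

Hence all parts have length 1 or 2, and the interval is one of finitely many local graphs. Those
violating 2-connectivity are excluded, one family is exceptional, and in each of the others a
configuration is found by a finite check (`exists_candidate_cross`, `exists_candidate_split`). -/

/-! ### Local pictures as lists of edges -/

/-- Adjacency in the graph on `ℕ` whose edges are listed in `E`. -/
abbrev ListAdj (E : List (ℕ × ℕ)) (i j : ℕ) : Prop := (i, j) ∈ E ∨ (j, i) ∈ E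

/-- The degree of `i` in the graph on `0, …, m` with edges `E`. -/
def listDegree (m : ℕ) (E : List (ℕ × ℕ)) (i : ℕ) : ℕ :=
  ((List.range (m + 1)).filter (fun j => decide (ListAdj E i j))).length

/-- The edges `pq` and `rs`, where `p < q` and `r < s`, cross. -/
abbrev Crosses (p q r s : ℕ) : Prop := (p < r ∧ r < q ∧ q < s) ∨ (r < p ∧ p < s ∧ s < q)

theorem crosses_add_left (a p q r s : ℕ) :
    Crosses (a + p) (a + q) (a + r) (a + s) ↔ Crosses p q r s := by
  unfold Crosses
  omega

/-- Interchanges `x` and `y`. -/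
def swapNat (x y i : ℕ) : ℕ := if i = x then y else if i = y then x else i

/-- After interchanging the inner positions `x`, `y` and adding the edge `uw`, every edge in `E` is crossed
at most once. -/
def SwapPlane (m : ℕ) (E : List (ℕ × ℕ)) (u w x y : ℕ) : Prop :=
  (0 < x ∧ x < m) ∧ (0 < y ∧ y < m) ∧ ((0 < u ∧ u < m) ∧ (0 < w ∧ w < m)) ∧
  ∀ e ∈ (u, w) :: E, ∀ e₁ ∈ (u, w) :: E, ∀ e₂ ∈ (u, w) :: E,
    Crosses (min (swapNat x y e.1) (swapNat x y e.2)) (max (swapNat x y e.1) (swapNat x y e.2))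
      (min (swapNat x y e₁.1) (swapNat x y e₁.2)) (max (swapNat x y e₁.1) (swapNat x y e₁.2)) →
    Crosses (min (swapNat x y e.1) (swapNat x y e.2)) (max (swapNat x y e.1) (swapNat x y e.2))
      (min (swapNat x y e₂.1) (swapNat x y e₂.2)) (max (swapNat x y e₂.1) (swapNat x y e₂.2)) →
    e₁ = e₂

instance (m : ℕ) (E : List (ℕ × ℕ)) (u w x y : ℕ) : Decidable (SwapPlane m E u w x y) := by
  unfold SwapPlane; infer_instance

/-- The map `g` embeds the picture `P` into the graph on `0, …, m` with edges `E`, whose inner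
vertices are those other than `0` and `m`. -/
def Embeds (m : ℕ) (E : List (ℕ × ℕ)) (P : Picture) (g : ℕ → ℕ) : Prop :=
  (∀ e ∈ P.edges, ListAdj E (g e.1) (g e.2)) ∧
  (∀ k ∈ P.solid, 0 < g k ∧ g k < m ∧ listDegree m E (g k) = P.degree k) ∧
  (∀ k < P.size, g k ≤ m ∧ P.degree k ≤ listDegree m E (g k)) ∧
  ∀ k < P.size, ∀ l < P.size, g k = g l → k = l

instance (m : ℕ) (E : List (ℕ × ℕ)) (P : Picture) (g : ℕ → ℕ) : Decidable (Embeds m E P g) := by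
  unfold Embeds; infer_instance

/-- The map `g` preserves or reverses the order of the vertices of `P`. -/
def PreservesOrder (P : Picture) (g : ℕ → ℕ) : Prop :=
  (∀ k < P.size, ∀ l < k, g l < g k) ∨ (∀ k < P.size, ∀ l < k, g k < g l)

instance (P : Picture) (g : ℕ → ℕ) : Decidable (PreservesOrder P g) := by
  unfold PreservesOrder; infer_instance

/-- A candidate for a copy of a picture: its index, the images of its vertices, and two positions to be
interchanged for property `𝔇₁`. -/
abbrev Candidate := ℕ × List ℕ × ℕ × ℕ

/-- The position of the vertex `k` of the picture. -/
abbrev Candidate.map (c : Candidate) (k : ℕ) : ℕ := c.2.1.getD k 0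

/-- The candidate is a copy of its picture in the local graph, apart from the conditions on the marked vertex. -/
def Candidate.Fits (m : ℕ) (E : List (ℕ × ℕ)) (c : Candidate) : Prop :=
  Embeds m E (picture c.1) c.map ∧ (6 ≤ c.1 → PreservesOrder (picture c.1) c.map) ∧
    (c.1 = 3 → SwapPlane m E (c.map 1) (c.map 2) c.2.2.1 c.2.2.2)

instance (m : ℕ) (E : List (ℕ × ℕ)) (c : Candidate) : Decidable (c.Fits m E) := by
  unfold Candidate.Fits; infer_instance

/-- The marked vertex is an inner vertex of degree at most seven. -/
def Candidate.MarkedInner (m : ℕ) (E : List (ℕ × ℕ)) (c : Candidate) : Prop :=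
  ∀ k ∈ (picture c.1).marked, 0 < c.map k ∧ c.map k < m ∧ listDegree m E (c.map k) ≤ 7

instance (m : ℕ) (E : List (ℕ × ℕ)) (c : Candidate) : Decidable (c.MarkedInner m E) := by
  unfold Candidate.MarkedInner; infer_instance

/-- The edges of a piece of the boundary between `x` and `x + l`, where `l ≤ 2`; the flag tells whether
the ends are adjacent. -/
def pieceEdges (x l : ℕ) (f : Bool) : List (ℕ × ℕ) :=
  (if f then [(x, x + l)] else []) ++ if l = 2 then [(x, x + 1), (x + 1, x + 2)] else []

/-- Two crossing edges and the three pieces between their ends. -/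
def crossEdges (l m r : ℕ) (f g h : Bool) : List (ℕ × ℕ) :=
  (0, l + m) :: (l, l + m + r) ::
    (pieceEdges 0 l f ++ (pieceEdges l m g ++ pieceEdges (l + m) r h))

/-- Two consecutive pieces. -/
def splitEdges (l r : ℕ) (f h : Bool) : List (ℕ × ℕ) :=
  pieceEdges 0 l f ++ pieceEdges l r h

/-- The indices of the configurations available in an interval with `k + 1` vertices. -/
def configs (k : ℕ) : Finset ℕ :=
  if k ≤ 3 then {1, 2} else if k = 4 then {1, 2, 3, 4, 6, 8, 13} else Finset.Icc 1 17

/-- Copies of pictures that occur in small local graphs. -/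
def candidates : List Candidate :=
  [(1, [0, 1, 2, 3], 1, 1), (5, [5, 4, 3, 2, 1, 0], 1, 1), (2, [2, 3, 1, 0], 1, 1),
   (1, [5, 2, 1, 0], 1, 1), (1, [1, 2, 3, 0], 1, 1), (2, [1, 2, 0, 5], 1, 1),
   (2, [1, 2, 0, 3], 1, 1), (5, [6, 5, 4, 3, 2, 0], 1, 1), (5, [4, 3, 2, 1, 0, 5], 1, 1),
   (5, [0, 1, 2, 3, 4, 5], 1, 1), (5, [4, 3, 2, 1, 0, 6], 1, 1), (2, [2, 1, 3, 5], 1, 1),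
   (2, [1, 2, 0, 4], 1, 1), (8, [0, 1, 2, 3, 4], 1, 1), (15, [5, 4, 3, 2, 1, 0], 1, 1),
   (14, [5, 4, 3, 2, 1, 0], 1, 1), (2, [3, 2, 4, 0], 1, 1), (1, [0, 2, 1, 3], 1, 1),
   (16, [0, 1, 2, 3, 4, 5], 1, 1), (10, [0, 1, 2, 3, 4, 5], 1, 1), (2, [3, 2, 4, 1], 1, 1),
   (1, [0, 1, 2, 4], 1, 1), (1, [3, 2, 1, 4], 1, 1), (2, [3, 4, 2, 0], 1, 1),
   (1, [3, 2, 1, 5], 1, 1), (1, [4, 3, 2, 0], 1, 1), (11, [6, 5, 4, 3, 2, 1, 0], 1, 1),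
   (9, [5, 4, 3, 2, 1, 0], 1, 1), (13, [4, 3, 2, 1, 0], 1, 1), (5, [0, 1, 2, 3, 4, 6], 1, 1),
   (13, [0, 1, 2, 3, 4], 1, 1), (2, [2, 1, 3, 4], 1, 1), (4, [4, 3, 2, 1, 0], 1, 1),
   (2, [2, 1, 0, 3], 1, 1), (8, [4, 3, 2, 1, 0], 1, 1), (2, [2, 1, 3, 0], 1, 1),
   (14, [0, 1, 2, 3, 4, 5], 1, 1), (17, [6, 5, 4, 3, 2, 1, 0], 1, 1), (10, [5, 4, 3, 2, 1, 0], 1, 1),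
   (15, [0, 1, 2, 3, 4, 5], 1, 1), (1, [2, 3, 4, 0], 1, 1), (5, [1, 2, 3, 4, 5, 0], 1, 1),
   (2, [1, 2, 3, 0], 1, 1), (5, [2, 3, 4, 5, 6, 0], 1, 1), (3, [4, 1, 3, 2], 1, 2),
   (3, [0, 1, 3, 2], 2, 3)]

/-! ### Finite verification -/

/-- The first two exclusions are the cases in which an inner end of a crossing chord would have
degree 1; the third one is the exceptional family. -/
theorem exists_candidate_cross : ∀ l ∈ [1, 2], ∀ m ∈ [1, 2], ∀ r ∈ [1, 2], ∀ f g h : Bool,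
    ¬ (l = 1 ∧ f = false ∧ m = 1 ∧ g = false) → ¬ (m = 1 ∧ g = false ∧ r = 1 ∧ h = false) →
    ¬ (l = 1 ∧ f = true ∧ r = 1 ∧ h = true ) →
    ∃ c ∈ candidates, c.1 ∈ configs (l + m + r) ∧
      c.Fits (l + m + r) (crossEdges l m r f g h) ∧
      c.MarkedInner (l + m + r) (crossEdges l m r f g h) := by
  decide +kernel

/-- An exclusion here means that an end of the interval is not joined to its part of length 1, which
would make the other end a cut vertex. -/
theorem exists_candidate_split : ∀ l ∈ [1, 2], ∀ r ∈ [1, 2], ∀ f h : Bool,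
    ¬ (l = 1 ∧ f = false) → ¬ (r = 1 ∧ h = false) → 3 ≤ l + r →
    ∃ c ∈ candidates, c.1 ∈ configs (l + r) ∧
      c.Fits (l + r) (splitEdges l r f h) ∧ c.MarkedInner (l + r) (splitEdges l r f h) := by
  decide +kernel

/-- An exceptional interval is itself a copy of `G₃` or `G₆` (`m = 1`) or of `G₇` or `G₁₂` (`m =
2`), except that the marked vertex is an end, whose degree the local graph does not determine. -/
theorem exists_candidate_marked_last : ∀ m ∈ [1, 2], ∀ g : Bool, ∀ k ∈ [4, 5], m + 2 < k →
    ∃ c : Candidate, c.1 ∈ configs k ∧ c.Fits (m + 2) (crossEdges 1 m 1 true g true) ∧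
      ∀ i ∈ (picture c.1).marked, c.map i = m + 2 := by
  intro m hm g k hk hmk
  -- The swap `1, 1` is the identity: in `G₃` the vertices `u`, `v` are consecutive here, so the
  -- edge between them crosses nothing. For pictures of size 4 the last list entry is not read.
  refine ⟨(if m = 1 then (if g then 6 else 3) else (if g then 12 else 7), [0, 1, 2, 3, 4], 1, 1), ?_⟩
  revert m g k
  decide +kernel

theorem exists_candidate_marked_first : ∀ m ∈ [1, 2], ∀ g : Bool, ∀ k ∈ [4, 5], m + 2 < k →
    ∃ c : Candidate, c.1 ∈ configs k ∧ c.Fits (m + 2) (crossEdges 1 m 1 true g true) ∧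
      ∀ i ∈ (picture c.1).marked, c.map i = 0 := by
  intro m hm g k hk hmk
  refine ⟨(if m = 1 then (if g then 6 else 3) else (if g then 12 else 7),
    if m = 1 then [3, 2, 1, 0] else [4, 3, 2, 1, 0], 1, 1), ?_⟩
  revert m g k
  decide +kernel

/-! ### Adjacency of boundary positions -/

/-- Every edge of `A` is crossed by at most one other edge. -/
def OnePlane (A : ℕ → ℕ → Prop) : Prop :=
  ∀ p q r s r' s' : ℕ, A p q → A r s → A r' s' → p < q → r < s → r' < s' →
    Crosses p q r s → Crosses p q r' s' → r = r' ∧ s = s'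

/-- `A` is the adjacency relation between the positions `0, …, n - 1` in an outer-1-plane drawing of
a 2-connected graph. -/
structure IsBoundaryRel (n : ℕ) (A : ℕ → ℕ → Prop) : Prop where
  symm : ∀ i j, A i j → A j i
  irrefl : ∀ i, ¬ A i i
  lt : ∀ i j, A i j → i < n
  onePlane : OnePlane A
  three_le : 3 ≤ n
  cut : ∀ (S : Set ℕ) (c d i : ℕ), i ∈ S → i < n → i ≠ c → d ∉ S → d < n → d ≠ c →
    ∃ x ∈ S, ∃ y ∉ S, x ≠ c ∧ y ≠ c ∧ A x y

/-- The degree of `i` with respect to `A`. -/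
noncomputable def relDegree (A : ℕ → ℕ → Prop) (i : ℕ) : ℕ := Set.ncard {j | A i j}

/-- The vertices strictly between `a` and `b` have all neighbours between `a` and `b`. -/
def ClosedInterval (A : ℕ → ℕ → Prop) (a b : ℕ) : Prop :=
  ∀ k j, a < k → k < b → A k j → a ≤ j ∧ j ≤ b

/-- An edge between `u` and `w` can be added, after the interchange of two positions, such that
every edge is still crossed at most once. -/
def Insertable (n : ℕ) (A : ℕ → ℕ → Prop) (u w : ℕ) : Prop :=
  ∃ x < n, ∃ y < n, OnePlane fun i j =>
    A (swapNat x y i) (swapNat x y j) ∨ (swapNat x y i = u ∧ swapNat x y j = w) ∨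
      (swapNat x y i = w ∧ swapNat x y j = u)

/-- One of the configurations with index in `S` occurs, with its solid and marked vertices strictly
between `a` and `b`. -/
def Found (n : ℕ) (A : ℕ → ℕ → Prop) (a b : ℕ) (S : Finset ℕ) : Prop :=
  ∃ i ∈ S, ∃ g : ℕ → ℕ,
    (∀ k < (picture i).size, g k < n) ∧
    (∀ k < (picture i).size, ∀ l < (picture i).size, g k = g l → k = l) ∧
    (∀ e ∈ (picture i).edges, A (g e.1) (g e.2)) ∧
    (∀ k ∈ (picture i).solid, relDegree A (g k) = (picture i).degree k) ∧
    (∀ k < (picture i).size, (picture i).degree k ≤ relDegree A (g k)) ∧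
    (∀ k ∈ (picture i).marked, relDegree A (g k) ≤ 7) ∧
    (∀ k ∈ (picture i).solid ∪ (picture i).marked, a < g k ∧ g k < b) ∧
    (i = 3 → Insertable n A (g 1) (g 2)) ∧
    (6 ≤ i → PreservesOrder (picture i) g)

theorem Found.mono {n : ℕ} {A : ℕ → ℕ → Prop} {a b a' b' : ℕ} {S S' : Finset ℕ}
    (h : Found n A a b S) (ha : a' ≤ a) (hb : b ≤ b') (hS : S ⊆ S') : Found n A a' b' S' := by
  obtain ⟨i, hi, g, h1, h2, h3, h4, h5, h6, h7, h8⟩ := h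
  refine ⟨i, hS hi, g, h1, h2, h3, h4, h5, h6, fun k hk => ?_, h8⟩
  have := h7 k hk
  omega

/-- Between `a` and `a + m` the relation is given by the list `E`, where the edge between the two ends is
disregarded. -/
structure LocalEdges (A : ℕ → ℕ → Prop) (a m : ℕ) (E : List (ℕ × ℕ)) : Prop where
  closed : ClosedInterval A a (a + m)
  mem : ∀ e ∈ E, e.1 < e.2 ∧ e.2 ≤ m ∧ (0 < e.1 ∨ e.2 < m)
  adj_iff : ∀ i j, i < j → j ≤ m → (0 < i ∨ j < m) → (A (a + i) (a + j) ↔ (i, j) ∈ E)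

/-! ### Transfer from edge lists to the boundary relation -/

section

variable {n : ℕ} {A : ℕ → ℕ → Prop}

theorem IsBoundaryRel.lt_right (hA : IsBoundaryRel n A) {i j : ℕ} (h : A i j) : j < n :=
  hA.lt _ _ (hA.symm _ _ h)

theorem IsBoundaryRel.finite (hA : IsBoundaryRel n A) (i : ℕ) : {j | A i j}.Finite :=
  (Set.finite_Iio n).subset fun _ h => hA.lt_right h

theorem relDegree_le (s : Finset ℕ) (i : ℕ) (h : ∀ j, A i j → j ∈ s) :
    relDegree A i ≤ s.card := by
  rw [← Set.ncard_coe_finset]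
  exact Set.ncard_le_ncard h s.finite_toSet

variable {a m : ℕ} {E : List (ℕ × ℕ)}

theorem LocalEdges.adj (hA : IsBoundaryRel n A) (h : LocalEdges A a m E) {i j : ℕ}
    (hij : ListAdj E i j) : A (a + i) (a + j) ∧ i ≤ m ∧ j ≤ m := by
  rcases hij with hij | hij
  · have := h.mem _ hij
    exact ⟨(h.adj_iff i j (by omega) (by omega) (by omega)).2 hij, by omega, by omega⟩
  · have := h.mem _ hij
    exact ⟨hA.symm _ _ ((h.adj_iff j i (by omega) (by omega) (by omega)).2 hij), by omega, by omega⟩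

theorem LocalEdges.listAdj (hA : IsBoundaryRel n A) (h : LocalEdges A a m E) {i k : ℕ}
    (h0 : 0 < i) (hm : i < m) (hk : A (a + i) k) : ∃ j ≤ m, k = a + j ∧ ListAdj E i j := by
  have hc := h.closed _ _ (by omega) (by omega) hk
  obtain ⟨j, rfl⟩ := Nat.exists_eq_add_of_le hc.1
  refine ⟨j, by omega, rfl, ?_⟩
  rcases lt_trichotomy i j with hij | rfl | hij
  · exact Or.inl ((h.adj_iff i j hij (by omega) (by omega)).1 hk)
  · exact (hA.irrefl _ hk).elim
  · exact Or.inr ((h.adj_iff j i hij (by omega) (by omega)).1 (hA.symm _ _ hk))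

theorem listDegree_eq_ncard (m : ℕ) (E : List (ℕ × ℕ)) (a i : ℕ) :
    listDegree m E i = Set.ncard {k | ∃ j ≤ m, k = a + j ∧ ListAdj E i j} := by
  have h : {k | ∃ j ≤ m, k = a + j ∧ ListAdj E i j} =
      (((Finset.range (m + 1)).filter (fun j => ListAdj E i j)).image (a + ·) : Finset ℕ) := by
    ext k
    simp only [Set.mem_ofPred_eq, Finset.coe_image, Finset.coe_filter, Finset.mem_range, Set.mem_image]
    constructor
    · rintro ⟨j, hj, rfl, h⟩
      exact ⟨j, ⟨by omega, h⟩, rfl⟩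
    · rintro ⟨j, ⟨hj, h⟩, rfl⟩
      exact ⟨j, by omega, rfl, h⟩
  rw [h, Set.ncard_coe_finset, Finset.card_image_of_injective _ (add_right_injective a)]
  rfl

/-- Only an inequality at the ends, which may have neighbours outside; this is all that hollow
vertices need. -/
theorem LocalEdges.listDegree_le (hA : IsBoundaryRel n A) (h : LocalEdges A a m E) (i : ℕ) :
    listDegree m E i ≤ relDegree A (a + i) := by
  rw [listDegree_eq_ncard m E a]
  refine Set.ncard_le_ncard ?_ (hA.finite _)
  rintro k ⟨j, hj, rfl, hij⟩
  exact (h.adj hA hij).1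

theorem LocalEdges.relDegree_eq (hA : IsBoundaryRel n A) (h : LocalEdges A a m E) {i : ℕ}
    (h0 : 0 < i) (hm : i < m) : relDegree A (a + i) = listDegree m E i := by
  refine le_antisymm ?_ (h.listDegree_le hA i)
  rw [listDegree_eq_ncard m E a]
  refine Set.ncard_le_ncard (fun k hk => h.listAdj hA h0 hm hk) ?_
  refine (Set.finite_Iic (a + m)).subset ?_
  rintro k ⟨j, hj, rfl, -⟩
  simp only [Set.mem_Iic]
  omega

/-- Swapping inner positions of a closed interval and adding an inner edge changes only edges that
stay inside the interval. These never cross the remaining edges, so the check on the list suffices.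
-/
theorem LocalEdges.insertable (hA : IsBoundaryRel n A) (h : LocalEdges A a m E) (hn : a + m < n)
    {u w x y : ℕ} (hs : SwapPlane m E u w x y) : Insertable n A (a + u) (a + w) := by
  obtain ⟨hx, hy, ⟨hu, hw⟩, hs⟩ := hs
  refine ⟨a + x, by omega, a + y, by omega, ?_⟩
  set B : ℕ → ℕ → Prop := fun i j => A (swapNat (a + x) (a + y) i) (swapNat (a + x) (a + y) j) ∨
    (swapNat (a + x) (a + y) i = a + u ∧ swapNat (a + x) (a + y) j = a + w) ∨
    (swapNat (a + x) (a + y) i = a + w ∧ swapNat (a + x) (a + y) j = a + u) with hB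
  have inner : ∀ p q, B p q → p < q → (a < p ∧ p < a + m ∨ a < q ∧ q < a + m) →
      ∃ e ∈ (u, w) :: E, p = a + min (swapNat x y e.1) (swapNat x y e.2) ∧
        q = a + max (swapNat x y e.1) (swapNat x y e.2) := by
    intro p q hpq hlt hin
    have key : ∃ i j, swapNat (a + x) (a + y) p = a + i ∧ swapNat (a + x) (a + y) q = a + j ∧
        ((i, j) ∈ (u, w) :: E ∨ (j, i) ∈ (u, w) :: E) := by
      rcases hpq with hpq | hpq | hpq
      · rcases hin with hin | hin
        · obtain ⟨i, hi⟩ : ∃ i, swapNat (a + x) (a + y) p = a + i :=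
            Nat.exists_eq_add_of_le (by unfold swapNat; split_ifs <;> omega)
          have hi' : 0 < i ∧ i < m := by unfold swapNat at hi; split_ifs at hi <;> omega
          rw [hi] at hpq
          obtain ⟨j, -, hj, hij⟩ := h.listAdj hA hi'.1 hi'.2 hpq
          exact ⟨i, j, hi, hj, hij.imp (List.mem_cons_of_mem _) (List.mem_cons_of_mem _)⟩
        · obtain ⟨j, hj⟩ : ∃ j, swapNat (a + x) (a + y) q = a + j :=
            Nat.exists_eq_add_of_le (by unfold swapNat; split_ifs <;> omega)
          have hj' : 0 < j ∧ j < m := by unfold swapNat at hj; split_ifs at hj <;> omega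
          rw [hj] at hpq
          obtain ⟨i, -, hi, hij⟩ := h.listAdj hA hj'.1 hj'.2 (hA.symm _ _ hpq)
          exact ⟨i, j, hi, hj, hij.symm.imp (List.mem_cons_of_mem _) (List.mem_cons_of_mem _)⟩
      · exact ⟨u, w, hpq.1, hpq.2, by simp⟩
      · exact ⟨w, u, hpq.1, hpq.2, by simp⟩
    obtain ⟨i, j, hi, hj, hij⟩ := key
    have hpi : p = a + swapNat x y i := by unfold swapNat at hi ⊢; split_ifs at hi ⊢ <;> omega
    have hqj : q = a + swapNat x y j := by unfold swapNat at hj ⊢; split_ifs at hj ⊢ <;> omega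
    rcases hij with hij | hij
    · exact ⟨_, hij, by dsimp only; omega, by dsimp only; omega⟩
    · exact ⟨_, hij, by dsimp only; omega, by dsimp only; omega⟩
  have outer : ∀ p q, B p q → ¬ (a < p ∧ p < a + m ∨ a < q ∧ q < a + m) → A p q := by
    intro p q hpq hout
    have hp : swapNat (a + x) (a + y) p = p := by unfold swapNat; split_ifs <;> omega
    have hq : swapNat (a + x) (a + y) q = q := by unfold swapNat; split_ifs <;> omega
    simp only [hB, hp, hq] at hpq
    rcases hpq with hpq | hpq | hpq
    · exact hpq
    · omega
    · omega
  have bound : ∀ e ∈ (u, w) :: E, swapNat x y e.1 ≤ m ∧ swapNat x y e.2 ≤ m := by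
    intro e he
    have : e.1 ≤ m ∧ e.2 ≤ m := by
      rcases List.mem_cons.1 he with rfl | he
      · exact ⟨hu.2.le, hw.2.le⟩
      · have := h.mem e he
        omega
    unfold swapNat
    split_ifs <;> omega
  -- Two crossing edges either both have an end strictly inside the interval, or neither has: the
  -- former kind stays within the interval, and the latter has no end strictly inside it.
  have cross : ∀ p q r s, B p q → B r s → p < q → r < s → Crosses p q r s →
      ((a < p ∧ p < a + m ∨ a < q ∧ q < a + m) ↔ (a < r ∧ r < a + m ∨ a < s ∧ s < a + m)) := by
    intro p q r s hpq hrs h1 h2 hc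
    constructor
    · intro hin
      obtain ⟨e, he, hp, hq⟩ := inner p q hpq h1 hin
      have := bound e he
      rcases hc with hc | hc <;> omega
    · intro hin
      obtain ⟨e, he, hp, hq⟩ := inner r s hrs h2 hin
      have := bound e he
      rcases hc with hc | hc <;> omega
  intro p q r s r' s' hpq hrs hrs' h1 h2 h3 hc hc'
  have e1 := cross p q r s hpq hrs h1 h2 hc
  have e2 := cross p q r' s' hpq hrs' h1 h3 hc'
  by_cases hin : a < p ∧ p < a + m ∨ a < q ∧ q < a + m
  · obtain ⟨e, he, rfl, rfl⟩ := inner p q hpq h1 hin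
    obtain ⟨e₁, he₁, rfl, rfl⟩ := inner r s hrs h2 (e1.1 hin)
    obtain ⟨e₂, he₂, rfl, rfl⟩ := inner r' s' hrs' h3 (e2.1 hin)
    rw [crosses_add_left] at hc hc'
    have := hs e he e₁ he₁ e₂ he₂ hc hc'
    subst this
    exact ⟨rfl, rfl⟩
  · exact hA.onePlane p q r s r' s' (outer p q hpq hin) (outer r s hrs fun H => hin (e1.2 H))
      (outer r' s' hrs' fun H => hin (e2.2 H)) h1 h2 h3 hc hc'

theorem LocalEdges.found (hA : IsBoundaryRel n A) (h : LocalEdges A a m E) (hn : a + m < n)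
    {c : Candidate} (hc : c.Fits m E) {lo hi : ℕ} (hlo : lo ≤ a) (hhi : a + m ≤ hi) {S : Finset ℕ}
    (hS : c.1 ∈ S) (hm : ∀ k ∈ (picture c.1).marked,
      lo < a + c.map k ∧ a + c.map k < hi ∧ relDegree A (a + c.map k) ≤ 7) :
    Found n A lo hi S := by
  obtain ⟨⟨h1, h2, h3, h4⟩, h5, h6⟩ := hc
  refine ⟨c.1, hS, fun k => a + c.map k, fun k hk => ?_, fun k hk l hl hkl => ?_, fun e he => ?_,
    fun k hk => ?_, fun k hk => ?_, fun k hk => (hm k hk).2.2, fun k hk => ?_, fun hi => ?_,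
    fun hi => ?_⟩
  · have := (h3 k hk).1
    dsimp only
    omega
  · exact h4 k hk l hl (by simpa using hkl)
  · exact (h.adj hA (h1 e he)).1
  · have := h2 k hk
    rw [h.relDegree_eq hA this.1 this.2.1, this.2.2]
  · exact (h3 k hk).2.trans (h.listDegree_le hA _)
  · rcases Finset.mem_union.1 hk with hk | hk
    · have := h2 k hk
      dsimp only
      omega
    · exact ⟨(hm k hk).1, (hm k hk).2.1⟩
  · exact h.insertable hA hn (h6 hi)
  · refine (h5 hi).imp (fun H k hk l hl => ?_) (fun H k hk l hl => ?_)
    · have := H k hk l hl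
      dsimp only
      omega
    · have := H k hk l hl
      dsimp only
      omega

theorem LocalEdges.found_of_markedInner (hA : IsBoundaryRel n A) (h : LocalEdges A a m E)
    (hn : a + m < n) {c : Candidate} (hc : c.Fits m E) {S : Finset ℕ} (hS : c.1 ∈ S)
    (hm : c.MarkedInner m E) : Found n A a (a + m) S := by
  refine h.found hA hn hc le_rfl le_rfl hS fun k hk => ?_
  have := hm k hk
  rw [h.relDegree_eq hA this.1 this.2.1]
  omega

end

/-! ### Decomposition of closed intervals -/

/-- A closed interval with at most one inner vertex, which is then adjacent to both ends; the flag tells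
whether the ends are adjacent. -/
structure IsPiece (A : ℕ → ℕ → Prop) (x l : ℕ) (f : Bool) : Prop where
  len : l = 1 ∨ l = 2
  closed : ClosedInterval A x (x + l)
  adj_iff : A x (x + l) ↔ f = true
  middle : l = 2 → A x (x + 1) ∧ A (x + 1) (x + 2)

/-- The interval from `x` to `x + k` consists of a path and two chords crossing each other and joining
the ends to the neighbours of the other ends, and possibly of a chord in the middle. -/
def Exceptional (A : ℕ → ℕ → Prop) (x k : ℕ) : Prop :=
  ∃ m ∈ [1, 2], ∃ g : Bool, k = m + 2 ∧ LocalEdges A x (m + 2) (crossEdges 1 m 1 true g true)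

/-- Each end of the interval from `x` to `y` has at most three neighbours in it, at
the indicated places. -/
def Slim (A : ℕ → ℕ → Prop) (x y : ℕ) : Prop :=
  (∀ j, A x j → x < j → j ≤ y → j = x + 1 ∨ j + 1 = y ∨ j = y) ∧
  (∀ j, A y j → j < y → x ≤ j → j = x ∨ j = x + 1 ∨ j + 1 = y)

section

variable {n : ℕ} {A : ℕ → ℕ → Prop}

/-- The two chords already cross each other, whereas an edge leaving one of the three parts would
cross at least one of them again. -/
theorem closedInterval_of_crosses (hA : IsBoundaryRel n A) {a z y b : ℕ} (haz : a < z) (hzy : z < y)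
    (hyb : y < b) (h1 : A a y) (h2 : A z b) (hc : ClosedInterval A a b) :
    ClosedInterval A a z ∧ ClosedInterval A z y ∧ ClosedInterval A y b := by
  have key1 : ∀ r s, A r s → r < s → Crosses a y r s → r = z ∧ s = b := fun r s h h' hx =>
    hA.onePlane a y r s z b h1 h h2 (by omega) h' (by omega) hx (Or.inl (by omega))
  have key2 : ∀ r s, A r s → r < s → Crosses z b r s → r = a ∧ s = y := fun r s h h' hx =>
    hA.onePlane z b r s a y h2 h h1 (by omega) h' (by omega) hx (Or.inr (by omega))
  unfold Crosses at key1 key2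
  refine ⟨fun k j h h' hkj => ?_, fun k j h h' hkj => ?_, fun k j h h' hkj => ?_⟩ <;>
  · have e0 := hc k j (by omega) (by omega) hkj
    have e1 := key1 k j hkj
    have e2 := key2 k j hkj
    have e3 := key1 j k (hA.symm _ _ hkj)
    have e4 := key2 j k (hA.symm _ _ hkj)
    omega

/-- Take `u < b` as large as possible with `[a,u]` closed. Once no inner neighbour of `a` lies
beyond `u`, the interval `[u,b]` is closed too. -/
theorem exists_split (hA : IsBoundaryRel n A) {a b : ℕ} (hab : a + 2 ≤ b)
    (hc : ClosedInterval A a b) (hx : ¬ ∃ z y, a < z ∧ z < y ∧ y < b ∧ A a y ∧ A z b) :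
    ∃ u, a < u ∧ u < b ∧ ClosedInterval A a u ∧ ClosedInterval A u b ∧
      ∀ k, A a k → a < k → k < b → k ≤ u := by
  classical
  let P : ℕ → Prop := fun u => a < u ∧ u < b ∧ ClosedInterval A a u
  have hP1 : P (a + 1) := ⟨by omega, by omega, fun k j h h' => by omega⟩
  have hPu : P (Nat.findGreatest P b) := Nat.findGreatest_spec (P := P) (m := a + 1) (by omega) hP1
  have hmax : ∀ q, P q → q ≤ Nat.findGreatest P b := fun q hq =>
    Nat.le_findGreatest hq.2.1.le hq
  set u := Nat.findGreatest P b
  obtain ⟨hau, hub, hcu⟩ := hPu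
  have hnb : ∀ k, A a k → a < k → k < b → k ≤ u := by
    intro k hak h1 h2
    -- If `ak` is crossed by `ts`, both chords have used up their crossing, so `[a,s]` is closed;
    -- the case `s = b` is ruled out by `hx`. If `ak` is uncrossed, `[a,k]` is closed.
    by_cases hcr : ∃ t s, a < t ∧ t < k ∧ k < s ∧ A t s
    · obtain ⟨t, s, hat, htk, hks, hts⟩ := hcr
      have hsb := (hc t s hat (by omega) hts).2
      have hsb' : s ≠ b := by
        rintro rfl
        exact hx ⟨t, k, hat, htk, h2, hak, hts⟩
      have : s ≤ u := by
        refine hmax s ⟨by omega, by omega, fun p j h h' hpj => ?_⟩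
        have e0 := hc p j h (by omega) hpj
        refine ⟨e0.1, ?_⟩
        by_contra hjs
        have e1 : Crosses a k p j → p = t ∧ j = s := fun hX =>
          hA.onePlane a k p j t s hak hpj hts h1 (by omega) (by omega) hX (Or.inl (by omega))
        have e2 : Crosses t s p j → p = a ∧ j = k := fun hX =>
          hA.onePlane t s p j a k hts hpj hak (by omega) (by omega) h1 hX (Or.inr (by omega))
        have e3 : p ≠ t ∨ j ≤ k := by
          by_contra hcon
          have := e1 (Or.inl (by omega))
          omega
        unfold Crosses at e1 e2
        omega
      omega
    · refine hmax k ⟨h1, h2, fun t s hat htk hts => ⟨(hc t s hat (by omega) hts).1, ?_⟩⟩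
      by_contra hks
      exact hcr ⟨t, s, hat, htk, by omega, hts⟩
  refine ⟨u, hau, hub, hcu, fun k j h h' hkj => ?_, hnb⟩
  have e0 := hc k j (by omega) h' hkj
  refine ⟨?_, e0.2⟩
  by_contra hju
  rcases e0.1.eq_or_lt with rfl | haj
  · have := hnb k (hA.symm _ _ hkj) (by omega) h'
    omega
  · have := hcu j k haj (by omega) (hA.symm _ _ hkj)
    omega

/-- Minimum degree 2: after the deletion of `c ≠ i`, the vertex `i` is still joined to the rest.
This is the cut property for `{i}`. -/
theorem IsBoundaryRel.exists_adj_ne (hA : IsBoundaryRel n A) {i : ℕ} (hi : i < n) (c : ℕ) :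
    ∃ j, j ≠ c ∧ A i j := by
  have key : ∀ c, i ≠ c → ∃ j, j ≠ c ∧ A i j := by
    intro c hic
    obtain ⟨d, hd, hdi, hdc⟩ : ∃ d, d < n ∧ d ≠ i ∧ d ≠ c := by
      have := hA.three_le
      by_cases h0 : 0 ≠ i ∧ 0 ≠ c
      · exact ⟨0, by omega, h0⟩
      by_cases h1 : 1 ≠ i ∧ 1 ≠ c
      · exact ⟨1, by omega, h1⟩
      exact ⟨2, by omega, by omega, by omega⟩
    obtain ⟨x, hx, y, -, -, hyc, hxy⟩ := hA.cut {i} c d i rfl hi hic hdi hd hdc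
    rw [Set.mem_singleton_iff] at hx
    subst hx
    exact ⟨y, hyc, hxy⟩
  rcases eq_or_ne i c with rfl | hic
  · obtain ⟨j, -, hij⟩ := key (i + 1) (by omega)
    exact ⟨j, fun h => hA.irrefl i (h ▸ hij), hij⟩
  · exact key c hic

theorem exists_isPiece (hA : IsBoundaryRel n A) {x l : ℕ} (hl : l = 1 ∨ l = 2) (hn : x + l < n)
    (hc : ClosedInterval A x (x + l)) : ∃ f, IsPiece A x l f := by
  classical
  refine ⟨decide (A x (x + l)), hl, hc, by simp, fun h2 => ?_⟩
  subst h2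
  have key : ∀ j, A (x + 1) j → j = x ∨ j = x + 2 := by
    intro j hj
    have := hc (x + 1) j (by omega) (by omega) hj
    have h' : j ≠ x + 1 := fun h => hA.irrefl _ (h ▸ hj)
    omega
  obtain ⟨j, hj, hj'⟩ := hA.exists_adj_ne (i := x + 1) (by omega) x
  obtain ⟨k, hk, hk'⟩ := hA.exists_adj_ne (i := x + 1) (by omega) (x + 2)
  have e1 := (key j hj').resolve_left hj
  have e2 := (key k hk').resolve_right hk
  subst e1 e2
  exact ⟨hA.symm _ _ hk', hj'⟩

theorem mem_pieceEdges {x l i j : ℕ} {f : Bool} (h : (i, j) ∈ pieceEdges x l f) (hl : l = 1 ∨ l = 2) :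
    x ≤ i ∧ i < j ∧ j ≤ x + l := by
  unfold pieceEdges at h
  rcases hl with rfl | rfl <;> cases f <;> simp at h <;> omega

theorem IsPiece.mem_iff {a x l i j : ℕ} {f : Bool} (h : IsPiece A (a + x) l f) (h1 : x ≤ i)
    (h2 : i < j) (h3 : j ≤ x + l) : A (a + i) (a + j) ↔ (i, j) ∈ pieceEdges x l f := by
  obtain ⟨hl, -, hf, hm⟩ := h
  obtain ⟨i, rfl⟩ := Nat.exists_eq_add_of_le h1
  obtain ⟨j, rfl⟩ := Nat.exists_eq_add_of_le (h1.trans h2.le)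
  simp only [← add_assoc]
  rcases hl with rfl | rfl
  · obtain ⟨rfl, rfl⟩ : i = 0 ∧ j = 1 := by omega
    simp [pieceEdges, hf]
  · have := hm rfl
    obtain ⟨rfl, rfl⟩ | ⟨rfl, rfl⟩ | ⟨rfl, rfl⟩ : (i = 0 ∧ j = 1) ∨ (i = 0 ∧ j = 2) ∨ (i = 1 ∧ j = 2) := by
      omega
    · simp [pieceEdges, this.1]
    · simp [pieceEdges, hf]
    · simp [pieceEdges, this.2]

theorem localEdges_split (hA : IsBoundaryRel n A) {a l r : ℕ} {f h : Bool} (hL : IsPiece A a l f)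
    (hR : IsPiece A (a + l) r h) (hc : ClosedInterval A a (a + (l + r))) :
    LocalEdges A a (l + r) (splitEdges l r f h) := by
  have hl := hL.len
  have hr := hR.len
  have hL0 : IsPiece A (a + 0) l f := hL
  refine ⟨hc, ?_, fun i j hij hj hij' => ?_⟩
  · rintro ⟨i, j⟩ he
    rcases List.mem_append.1 he with he | he <;> have := mem_pieceEdges he (by omega) <;>
      dsimp only <;> omega
  · unfold splitEdges
    rw [List.mem_append]
    constructor
    · intro hadj
      have e1 := hL.closed (a + i) (a + j)
      have e2 := hR.closed (a + j) (a + i)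
      have e3 := hA.symm _ _ hadj
      by_cases hjl : j ≤ l
      · exact Or.inl ((hL0.mem_iff (by omega) hij (by omega)).1 hadj)
      · refine Or.inr ((hR.mem_iff ?_ hij (by omega)).1 hadj)
        by_contra hil
        rcases Nat.eq_zero_or_pos i with h0 | h0
        · have := e2 (by omega) (by omega) e3
          omega
        · have := e1 (by omega) (by omega) hadj
          omega
    · rintro (he | he)
      · have := mem_pieceEdges he hl
        exact (hL0.mem_iff (by omega) hij (by omega)).2 he
      · have := mem_pieceEdges he hr
        exact (hR.mem_iff (by omega) hij (by omega)).2 he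

theorem localEdges_cross (hA : IsBoundaryRel n A) {a l m r : ℕ} {f g h : Bool}
    (hL : IsPiece A a l f) (hM : IsPiece A (a + l) m g) (hR : IsPiece A (a + (l + m)) r h)
    (h1 : A a (a + (l + m))) (h2 : A (a + l) (a + (l + m + r)))
    (hc : ClosedInterval A a (a + (l + m + r))) :
    LocalEdges A a (l + m + r) (crossEdges l m r f g h) := by
  have hl := hL.len
  have hm := hM.len
  have hr := hR.len
  have hL0 : IsPiece A (a + 0) l f := hL
  have hmem : ∀ i j, (i, j) ∈ crossEdges l m r f g h ↔ (i = 0 ∧ j = l + m) ∨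
      (i = l ∧ j = l + m + r) ∨ (i, j) ∈ pieceEdges 0 l f ∨ (i, j) ∈ pieceEdges l m g ∨
      (i, j) ∈ pieceEdges (l + m) r h := by
    intro i j
    simp only [crossEdges, List.mem_cons, List.mem_append, Prod.mk.injEq]
  refine ⟨hc, ?_, fun i j hij hj hij' => ?_⟩
  · rintro ⟨i, j⟩ he
    rcases (hmem i j).1 he with he | he | he | he | he
    · dsimp only; omega
    · dsimp only; omega
    all_goals
      have := mem_pieceEdges he (by omega)
      dsimp only
      omega
  · rw [hmem]
    constructor
    · intro hadj
      have e3 := hA.symm _ _ hadj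
      have e1 := fun u v => hL.closed (a + i) (a + j) u v hadj
      have e2 := fun u v => hM.closed (a + i) (a + j) u v hadj
      have e4 := fun u v => hM.closed (a + j) (a + i) u v e3
      have e5 := fun u v => hR.closed (a + j) (a + i) u v e3
      by_cases c1 : j ≤ l
      · exact Or.inr (Or.inr (Or.inl ((hL0.mem_iff (by omega) hij (by omega)).1 hadj)))
      by_cases c2 : l ≤ i ∧ j ≤ l + m
      · exact Or.inr (Or.inr (Or.inr (Or.inl ((hM.mem_iff (by omega) hij (by omega)).1 hadj))))
      by_cases c3 : l + m ≤ i
      · exact Or.inr (Or.inr (Or.inr (Or.inr ((hR.mem_iff (by omega) hij (by omega)).1 hadj))))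
      omega
    · rintro (⟨rfl, rfl⟩ | ⟨rfl, rfl⟩ | he | he | he)
      · exact h1
      · exact h2
      · have := mem_pieceEdges he hl
        exact (hL0.mem_iff (by omega) hij (by omega)).2 he
      · have := mem_pieceEdges he hm
        exact (hM.mem_iff (by omega) hij (by omega)).2 he
      · have := mem_pieceEdges he hr
        exact (hR.mem_iff (by omega) hij (by omega)).2 he

theorem Exceptional.slim (hA : IsBoundaryRel n A) {x k : ℕ} (h : Exceptional A x k) :
    Slim A x (x + k) := by
  obtain ⟨m, hm, g, rfl, h⟩ := h
  have key : ∀ m ∈ [1, 2], ∀ g : Bool, ∀ e ∈ crossEdges 1 m 1 true g true,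
      (e.1 = 0 → e.2 = 1 ∨ e.2 + 1 = m + 2) ∧ (e.2 = m + 2 → e.1 = 1 ∨ e.1 + 1 = m + 2) := by
    decide
  refine ⟨fun j hj h1 h2 => ?_, fun j hj h1 h2 => ?_⟩
  · obtain ⟨j, rfl⟩ := Nat.exists_eq_add_of_le h1.le
    by_cases hjm : j = m + 2
    · omega
    · have := (key m hm g _ ((h.adj_iff 0 j (by omega) (by omega) (by omega)).1 hj)).1 rfl
      omega
  · obtain ⟨j, rfl⟩ := Nat.exists_eq_add_of_le h2
    by_cases hj0 : j = 0
    · omega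
    · have := (key m hm g _
        ((h.adj_iff j (m + 2) (by omega) (by omega) (by omega)).1 (hA.symm _ _ hj))).2 rfl
      omega

theorem slim_of_le_two {x k : ℕ} (hk : k ≤ 2) : Slim A x (x + k) :=
  ⟨fun j _ _ _ => by omega, fun j _ _ _ => by omega⟩

theorem configs_mono {k k' : ℕ} (h : k ≤ k') : configs k ⊆ configs k' := by
  have h1 : ({1, 2} : Finset ℕ) ⊆ {1, 2, 3, 4, 6, 8, 13} := by decide
  have h2 : ({1, 2, 3, 4, 6, 8, 13} : Finset ℕ) ⊆ Finset.Icc 1 17 := by decide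
  unfold configs
  split_ifs
  all_goals first | omega | exact h1 | exact h2 | exact h1.trans h2 | exact subset_rfl

theorem Exceptional.found (hA : IsBoundaryRel n A) {x k : ℕ} (h : Exceptional A x k) (hn : x + k < n)
    {lo hi : ℕ} (hlo : lo ≤ x) (hhi : x + k ≤ hi)
    (hend : (x + k < hi ∧ relDegree A (x + k) ≤ 7) ∨ (lo < x ∧ relDegree A x ≤ 7)) :
    Found n A lo hi (configs (hi - lo)) := by
  obtain ⟨m, hm, g, rfl, h⟩ := h
  have hm' : m = 1 ∨ m = 2 := by simpa using hm
  rcases hend with hend | hend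
  · obtain ⟨c, hc, hcf, hcm⟩ := exists_candidate_marked_last m hm g (m + 3)
      (by rcases hm' with rfl | rfl <;> simp) (by omega)
    refine h.found hA hn hcf hlo hhi (configs_mono (by omega) hc) fun i hi => ?_
    rw [hcm i hi]
    exact ⟨by omega, hend⟩
  · obtain ⟨c, hc, hcf, hcm⟩ := exists_candidate_marked_first m hm g (m + 3)
      (by rcases hm' with rfl | rfl <;> simp) (by omega)
    refine h.found hA hn hcf hlo hhi (configs_mono (by omega) hc) fun i hi => ?_
    rw [hcm i hi]
    exact ⟨hend.1, by omega, hend.2⟩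

/-! ### The induction on closed intervals -/

theorem slim_of_le_two_or_exceptional (hA : IsBoundaryRel n A) {x k : ℕ} (h : k ≤ 2 ∨ Exceptional A x k) :
    Slim A x (x + k) :=
  h.elim slim_of_le_two fun h => h.slim hA

theorem found_or_exceptional (hA : IsBoundaryRel n A) : ∀ k a : ℕ, 3 ≤ k → a + k < n →
    ClosedInterval A a (a + k) → Found n A a (a + k) (configs k) ∨ Exceptional A a k := by
  intro k
  induction k using Nat.strong_induction_on with
  | _ k ih =>
  intro a hk hn hc
  by_cases hF : Found n A a (a + k) (configs k)
  · exact Or.inl hF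
  have sub : ∀ x l, a ≤ x → x + l ≤ a + k → l < k → ClosedInterval A x (x + l) →
      l ≤ 2 ∨ Exceptional A x l := by
    intro x l h1 h2 h3 h4
    by_cases hl : l ≤ 2
    · exact Or.inl hl
    · exact Or.inr ((ih l h3 x (by omega) (by omega) h4).resolve_left fun h =>
        hF (h.mono h1 h2 (configs_mono (by omega))))
  -- An exceptional part with a division vertex of degree at most 7 as an end would contradict `hF`.
  have small : ∀ x l, a ≤ x → x + l ≤ a + k → (l ≤ 2 ∨ Exceptional A x l) →
      ((x + l < a + k ∧ relDegree A (x + l) ≤ 7) ∨ (a < x ∧ relDegree A x ≤ 7)) → l ≤ 2 := by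
    intro x l h1 h2 h3 h4
    refine h3.resolve_right fun h => hF ?_
    have := h.found hA (by omega) h1 h2 h4
    rwa [Nat.add_sub_cancel_left] at this
  by_cases hx : ∃ z y, a < z ∧ z < y ∧ y < a + k ∧ A a y ∧ A z (a + k)
  · obtain ⟨z, y, haz, hzy, hyb, hay, hzb⟩ := hx
    obtain ⟨c1, c2, c3⟩ := closedInterval_of_crosses hA haz hzy hyb hay hzb hc
    obtain ⟨l, rfl⟩ := Nat.exists_eq_add_of_le haz.le
    obtain ⟨m, rfl⟩ := Nat.exists_eq_add_of_le hzy.le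
    obtain ⟨r, hr⟩ := Nat.exists_eq_add_of_le hyb.le
    obtain rfl : k = l + m + r := by omega
    rw [hr] at c3
    have s1 := sub a l le_rfl (by omega) (by omega) c1
    have s2 := sub (a + l) m (by omega) (by omega) (by omega) c2
    have s3 := sub (a + l + m) r (by omega) (by omega) (by omega) c3
    have t1 := slim_of_le_two_or_exceptional hA s1
    have t2 := slim_of_le_two_or_exceptional hA s2
    have t3 := slim_of_le_two_or_exceptional hA s3
    -- At most three neighbours in each of the two adjacent parts, and the far end of the crossing
    -- chord.
    have dz : relDegree A (a + l) ≤ 7 := by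
      refine (relDegree_le {a, a + 1, a + l - 1, a + l + 1, a + l + m - 1, a + l + m,
        a + (l + m + r)} _ fun j hj => ?_).trans
        ((Finset.card_insert_le _ _).trans (Nat.succ_le_succ Finset.card_le_six))
      have e0 := hc _ _ (by omega) (by omega) hj
      have e1 := t1.2 j hj
      have e2 := t2.1 j hj
      have e3 := fun u v => c3 j _ u v (hA.symm _ _ hj)
      have e4 : j ≠ a + l := fun h => hA.irrefl _ (h ▸ hj)
      simp only [Finset.mem_insert, Finset.mem_singleton]
      omega
    have dy : relDegree A (a + l + m) ≤ 7 := by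
      refine (relDegree_le {a, a + l, a + l + 1, a + l + m - 1, a + l + m + 1, a + (l + m + r) - 1,
        a + (l + m + r)} _ fun j hj => ?_).trans
        ((Finset.card_insert_le _ _).trans (Nat.succ_le_succ Finset.card_le_six))
      have e0 := hc _ _ (by omega) (by omega) hj
      have e1 := t2.2 j hj
      have e2 := t3.1 j hj
      have e3 := fun u v => c1 j _ u v (hA.symm _ _ hj)
      have e4 : j ≠ a + l + m := fun h => hA.irrefl _ (h ▸ hj)
      simp only [Finset.mem_insert, Finset.mem_singleton]
      omega
    have l1 := small _ _ le_rfl (by omega) s1 (Or.inl ⟨by omega, dz⟩)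
    have l2 := small _ _ (by omega) (by omega) s2 (Or.inl ⟨by omega, dy⟩)
    have l3 := small _ _ (by omega) (by omega) s3 (Or.inr ⟨by omega, dy⟩)
    obtain ⟨f, hf⟩ := exists_isPiece hA (by omega) (by omega) c1
    obtain ⟨g, hg⟩ := exists_isPiece hA (by omega) (by omega) c2
    obtain ⟨h, hh⟩ := exists_isPiece hA (by omega) (by omega) c3
    rw [add_assoc a l m] at hh hay
    have hloc := localEdges_cross hA hf hg hh hay hzb hc
    have ml : l ∈ [1, 2] := by simp; omega
    have mm : m ∈ [1, 2] := by simp; omega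
    have mr : r ∈ [1, 2] := by simp; omega
    by_cases hexc : l = 1 ∧ f = true ∧ r = 1 ∧ h = true
    · obtain ⟨rfl, rfl, rfl, rfl⟩ := hexc
      refine Or.inr ⟨m, mm, g, by omega, ?_⟩
      rwa [show m + 2 = 1 + m + 1 by omega]
    · refine absurd ?_ hF
      -- Otherwise the right end of the interval would be the only neighbour of `a + 1`.
      have h01 : ¬ (l = 1 ∧ f = false ∧ m = 1 ∧ g = false) := by
        rintro ⟨rfl, rfl, rfl, rfl⟩
        obtain ⟨j, hj, hj'⟩ := hA.exists_adj_ne (i := a + 1) (by omega) (a + (1 + 1 + r))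
        have e0 := hc _ _ (by omega) (by omega) hj'
        have e1 : j ≠ a := by
          rintro rfl
          exact absurd (hf.adj_iff.1 (hA.symm _ _ hj')) (by simp)
        have e2 : j ≠ a + 1 + 1 := by
          rintro rfl
          exact absurd (hg.adj_iff.1 hj') (by simp)
        have e3 := fun u v => c3 j _ u v (hA.symm _ _ hj')
        have e4 : j ≠ a + 1 := fun h => hA.irrefl _ (h ▸ hj')
        omega
      have h02 : ¬ (m = 1 ∧ g = false ∧ r = 1 ∧ h = false) := by
        rintro ⟨rfl, rfl, rfl, rfl⟩
        obtain ⟨j, hj, hj'⟩ := hA.exists_adj_ne (i := a + l + 1) (by omega) a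
        have e0 := hc _ _ (by omega) (by omega) hj'
        have e1 : j ≠ a + l := by
          rintro rfl
          exact absurd (hg.adj_iff.1 (hA.symm _ _ hj')) (by simp)
        have e2 : j ≠ a + (l + 1) + 1 := by
          rintro rfl
          exact absurd (hh.adj_iff.1 hj') (by simp)
        have e3 := fun u v => c1 j _ u v (hA.symm _ _ hj')
        have e4 : j ≠ a + l + 1 := fun h => hA.irrefl _ (h ▸ hj')
        omega
      obtain ⟨c, -, hcS, hcF, hcM⟩ := exists_candidate_cross l ml m mm r mr f g h h01 h02 hexc
      exact hloc.found_of_markedInner hA hn hcF hcS hcM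
  · obtain ⟨u, hau, hub, c1, c2, hnb⟩ := exists_split hA (by omega) hc hx
    obtain ⟨l, rfl⟩ := Nat.exists_eq_add_of_le hau.le
    obtain ⟨r, hr⟩ := Nat.exists_eq_add_of_le hub.le
    obtain rfl : k = l + r := by omega
    rw [hr] at c2
    have s1 := sub a l le_rfl (by omega) (by omega) c1
    have s2 := sub (a + l) r (by omega) (by omega) (by omega) c2
    have t1 := slim_of_le_two_or_exceptional hA s1
    have t2 := slim_of_le_two_or_exceptional hA s2
    have du : relDegree A (a + l) ≤ 7 := by
      refine (relDegree_le {a, a + 1, a + l - 1, a + l + 1, a + l + r - 1, a + l + r} _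
        fun j hj => ?_).trans (Finset.card_le_six.trans (by omega))
      have e0 := hc _ _ (by omega) (by omega) hj
      have e1 := t1.2 j hj
      have e2 := t2.1 j hj
      have e4 : j ≠ a + l := fun h => hA.irrefl _ (h ▸ hj)
      simp only [Finset.mem_insert, Finset.mem_singleton]
      omega
    have l1 := small _ _ le_rfl (by omega) s1 (Or.inl ⟨by omega, du⟩)
    have l2 := small _ _ (by omega) (by omega) s2 (Or.inr ⟨by omega, du⟩)
    obtain ⟨f, hf⟩ := exists_isPiece hA (by omega) (by omega) c1
    obtain ⟨h, hh⟩ := exists_isPiece hA (by omega) (by omega) c2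
    refine absurd ?_ hF
    have ml : l ∈ [1, 2] := by simp; omega
    have mr : r ∈ [1, 2] := by simp; omega
    -- After the deletion of the right end, the inner vertices reach the rest only through `a`; by
    -- `hnb` the only possible neighbour of `a` among them is `a + 1`.
    have h01 : ¬ (l = 1 ∧ f = false) := by
      rintro ⟨rfl, rfl⟩
      obtain ⟨i, hi, j, hj, hib, hjb, hij⟩ := hA.cut {j | a < j ∧ j < a + (1 + r)} (a + (1 + r)) a
        (a + 1) ⟨by omega, by omega⟩ (by omega) (by omega) (by simp) (by omega) (by omega)
      have e0 := hc _ _ hi.1 hi.2 hij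
      obtain rfl : j = a := by
        by_contra hne
        exact hj ⟨by omega, by omega⟩
      have e1 := hnb i (hA.symm _ _ hij) hi.1 hi.2
      obtain rfl : i = j + 1 := by have := hi.1; omega
      exact absurd (hf.adj_iff.1 (hA.symm _ _ hij)) (by simp)
    have h02 : ¬ (r = 1 ∧ h = false) := by
      rintro ⟨rfl, rfl⟩
      obtain ⟨i, hi, j, hj, hib, hjb, hij⟩ := hA.cut {j | a < j ∧ j < a + (l + 1)} a (a + (l + 1))
        (a + 1) ⟨by omega, by omega⟩ (by omega) (by omega) (by simp) (by omega) (by omega)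
      have e0 := hc _ _ hi.1 hi.2 hij
      obtain rfl : j = a + l + 1 := by
        by_contra hne
        exact hj ⟨by omega, by omega⟩
      have e1 := fun v => c1 i _ hi.1 v hij
      obtain rfl : i = a + l := by
        have h1 := hi.1
        have h2 := hi.2
        omega
      exact absurd (hh.adj_iff.1 hij) (by simp)
    obtain ⟨c, -, hcS, hcF, hcM⟩ := exists_candidate_split l ml r mr f h h01 h02 hk
    exact (localEdges_split hA hf hh hc).found_of_markedInner hA hn hcF hcS hcM

end

/-! ### Graphs with a boundary order -/

/-- Adjacency of the positions in the boundary order `v`. -/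
def boundaryRel {V : Type*} {n : ℕ} (G : SimpleGraph V) (v : Fin n ≃ V) (i j : ℕ) : Prop :=
  ∃ (hi : i < n) (hj : j < n), G.Adj (v ⟨i, hi⟩) (v ⟨j, hj⟩)

section

variable {V : Type*} {n : ℕ} {G : SimpleGraph V} {v : Fin n ≃ V}

theorem boundaryRel_val {i j : Fin n} : boundaryRel G v i j ↔ G.Adj (v i) (v j) :=
  ⟨fun ⟨_, _, h⟩ => h, fun h => ⟨i.2, j.2, h⟩⟩

theorem IsOuterOnePlane.onePlane (h : IsOuterOnePlane G v) : OnePlane (boundaryRel G v) := by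
  rintro p q r s r' s' ⟨hp, hq, hpq⟩ ⟨hr, hs, hrs⟩ ⟨hr', hs', hrs'⟩ h1 h2 h3 hc hc'
  have key : ∀ r s (hr : r < n) (hs : s < n), r < s → Crosses p q r s →
      EdgesCross v (v ⟨p, hp⟩) (v ⟨q, hq⟩) (v ⟨r, hr⟩) (v ⟨s, hs⟩) := by
    intro r s hr hs hrs hc
    simp only [EdgesCross, InCyclicOrder, Equiv.symm_apply_apply, Fin.lt_def]
    unfold Crosses at hc
    omega
  have := h _ _ _ _ _ _ hpq hrs hrs' (key r s hr hs h2 hc) (key r' s' hr' hs' h3 hc')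
  simp only [Sym2.eq_iff, EmbeddingLike.apply_eq_iff_eq, Fin.mk.injEq] at this
  omega

theorem IsOuterOnePlane.of_onePlane {B : ℕ → ℕ → Prop} (hB : OnePlane B)
    (h : ∀ i j : Fin n, G.Adj (v i) (v j) → B i j) : IsOuterOnePlane G v := by
  have sorted : ∀ i j : Fin n, G.Adj (v i) (v j) →
      ∃ p q : Fin n, s(v i, v j) = s(v p, v q) ∧ p < q ∧ B p q ∧ (i = p ∧ j = q ∨ i = q ∧ j = p) := by
    intro i j hij
    rcases lt_trichotomy i j with hlt | rfl | hlt
    · exact ⟨i, j, rfl, hlt, h _ _ hij, by simp⟩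
    · exact (G.irrefl hij).elim
    · exact ⟨j, i, Sym2.eq_swap, hlt, h _ _ hij.symm, by simp⟩
  have crosses : ∀ {i j k l p q r s : Fin n}, p < q → r < s → (i = p ∧ j = q ∨ i = q ∧ j = p) →
      (k = r ∧ l = s ∨ k = s ∧ l = r) → EdgesCross v (v i) (v j) (v k) (v l) →
      Crosses p q r s := by
    intro i j k l p q r s hpq hrs hij hkl hc
    simp only [EdgesCross, InCyclicOrder, Equiv.symm_apply_apply, Fin.lt_def] at hc
    unfold Crosses
    rw [Fin.lt_def] at hpq hrs
    rcases hij with ⟨rfl, rfl⟩ | ⟨rfl, rfl⟩ <;> rcases hkl with ⟨rfl, rfl⟩ | ⟨rfl, rfl⟩ <;> omega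
  intro a b c d c' d' hab hcd hcd' hx hx'
  obtain ⟨a, rfl⟩ := v.surjective a
  obtain ⟨b, rfl⟩ := v.surjective b
  obtain ⟨c, rfl⟩ := v.surjective c
  obtain ⟨d, rfl⟩ := v.surjective d
  obtain ⟨c', rfl⟩ := v.surjective c'
  obtain ⟨d', rfl⟩ := v.surjective d'
  obtain ⟨p, q, -, hpq, hBpq, e⟩ := sorted a b hab
  obtain ⟨r, s, e1, hrs, hBrs, e'⟩ := sorted c d hcd
  obtain ⟨r', s', e2, hrs', hBrs', e''⟩ := sorted c' d' hcd'
  have := hB p q r s r' s' hBpq hBrs hBrs' hpq hrs hrs' (crosses hpq hrs e e' hx)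
    (crosses hpq hrs' e e'' hx')
  rw [e1, e2, Fin.ext this.1, Fin.ext this.2]

theorem TwoConnected.isBoundaryRel (hG : TwoConnected G) (h : IsOuterOnePlane G v) :
    IsBoundaryRel n (boundaryRel G v) where
  symm := fun _ _ ⟨hi, hj, h⟩ => ⟨hj, hi, h.symm⟩
  irrefl := fun _ ⟨_, _, h⟩ => G.irrefl h
  lt := fun _ _ ⟨hi, _, _⟩ => hi
  onePlane := h.onePlane
  three_le := by
    have := hG.1
    rwa [← Nat.card_congr v, Nat.card_fin] at this
  cut := by
    intro S c d i hiS hi hic hdS hd hdc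
    -- A walk from `i` to `d` that avoids `c` has an edge leaving `S`. The graph `H` is kept general
    -- so that its vertex set can be rewritten as the complement of a singleton.
    have key : ∀ H : SimpleGraph {x : V | ((v.symm x : Fin n) : ℕ) ≠ c}, H.Preconnected →
        (∀ x y, H.Adj x y → G.Adj x.1 y.1) →
        ∃ x ∈ S, ∃ y ∉ S, x ≠ c ∧ y ≠ c ∧ boundaryRel G v x y := by
      intro H hH hHG
      obtain ⟨w⟩ := hH ⟨v ⟨i, hi⟩, by simpa using hic⟩ ⟨v ⟨d, hd⟩, by simpa using hdc⟩
      obtain ⟨e, -, he1, he2⟩ := w.exists_boundary_dart {x | ((v.symm x.1 : Fin n) : ℕ) ∈ S}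
        (by simpa using hiS) (by simpa using hdS)
      refine ⟨_, he1, _, he2, e.fst.2, e.snd.2, ?_⟩
      rw [boundaryRel_val]
      simpa using hHG _ _ e.adj
    by_cases hc : c < n
    · have hset : {x : V | ((v.symm x : Fin n) : ℕ) ≠ c} = {v ⟨c, hc⟩}ᶜ := by
        ext x
        simp [← Equiv.symm_apply_eq, Fin.ext_iff]
      refine key (G.induce _) ?_ fun x y hxy => hxy
      rw [hset]
      exact (hG.2.2 _).preconnected
    -- Here `c` is not a position, so nothing is deleted and connectivity of `G` is enough.
    · obtain ⟨w⟩ := hG.2.1.preconnected (v ⟨i, hi⟩) (v ⟨d, hd⟩)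
      obtain ⟨e, -, he1, he2⟩ := w.exists_boundary_dart {x | ((v.symm x : Fin n) : ℕ) ∈ S}
        (by simpa using hiS) (by simpa using hdS)
      refine ⟨_, he1, _, he2, by omega, by omega, ?_⟩
      rw [boundaryRel_val]
      simpa using e.adj

theorem relDegree_boundaryRel [Fintype V] [DecidableRel G.Adj] (i : Fin n) :
    relDegree (boundaryRel G v) i = G.degree (v i) := by
  rw [← G.card_neighborFinset_eq_degree, ← Set.ncard_coe_finset, relDegree]
  refine Set.ncard_congr' ⟨fun j => ⟨v ⟨j.1, j.2.2.1⟩, ?_⟩, fun x => ⟨v.symm x.1, ?_⟩,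
    fun j => ?_, fun x => ?_⟩
  · obtain ⟨j, hi, hj, h⟩ := j
    simpa using h
  · have := x.2
    exact boundaryRel_val.2 (by simpa using this)
  · simp
  · simp

theorem Insertable.outerOnePlanar {i j : Fin n} (h : Insertable n (boundaryRel G v) i j) :
    OuterOnePlanar (G ⊔ SimpleGraph.edge (v i) (v j)) := by
  obtain ⟨x, hx, y, hy, hB⟩ := h
  have hswap : ∀ k : Fin n, ((Equiv.swap (⟨x, hx⟩ : Fin n) ⟨y, hy⟩ k : Fin n) : ℕ) = swapNat x y k := by
    intro k
    rw [Equiv.swap_apply_def, swapNat]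
    simp only [Fin.ext_iff]
    split_ifs <;> rfl
  refine ⟨n, (Equiv.swap (⟨x, hx⟩ : Fin n) ⟨y, hy⟩).trans v,
    IsOuterOnePlane.of_onePlane hB fun k l hkl => ?_⟩
  simp only [← hswap]
  rw [boundaryRel_val]
  simp only [SimpleGraph.sup_adj, SimpleGraph.edge_adj, Equiv.trans_apply,
    EmbeddingLike.apply_eq_iff_eq] at hkl
  simp only [Fin.val_inj]
  tauto

theorem Found.properlyContains [Fintype V] [DecidableRel G.Adj] (h0 : 0 < n) {S : Finset ℕ}
    (h : Found n (boundaryRel G v) 0 (n - 1) S) :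
    ∃ i ∈ S, ∃ f : ℕ → V,
      ProperlyContainsAt G (v ⟨0, h0⟩) (v ⟨n - 1, by omega⟩) (picture i) f ∧
        PropertyD1 G i f ∧ PropertyD2 v i f := by
  obtain ⟨i, hi, g, hlt, hinj, hadj, hsol, hdeg, hmark, hin, hD1, hD2⟩ := h
  -- The default value occurs only at indices that are not vertices of the picture.
  let f : ℕ → V := fun k => if hk : g k < n then v ⟨g k, hk⟩ else v ⟨0, h0⟩
  have hf : ∀ k (hk : g k < n), f k = v ⟨g k, hk⟩ := fun k hk => dif_pos hk
  have hin' : ∀ k ∈ (picture i).solid ∪ (picture i).marked, g k < n := fun k hk => by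
    have := hin k hk
    omega
  have hfdeg : ∀ k, g k < n → G.degree (f k) = relDegree (boundaryRel G v) (g k) := by
    intro k hk
    rw [hf k hk]
    exact (relDegree_boundaryRel ⟨g k, hk⟩).symm
  refine ⟨i, hi, f, ⟨⟨?_, ?_, ?_, ?_, ?_⟩, ?_⟩, ?_, ?_⟩
  · intro k hk l hl hkl
    rw [hf k (hlt k hk), hf l (hlt l hl)] at hkl
    exact hinj k hk l hl (by simpa using hkl)
  · intro e he
    obtain ⟨h1, h2, h⟩ := hadj e he
    rwa [hf _ h1, hf _ h2]
  · intro k hk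
    rw [hfdeg k (hin' k (Finset.mem_union_left _ hk)), hsol k hk]
  · intro k hk _
    rw [hfdeg k (hlt k hk)]
    exact hdeg k hk
  · intro k hk
    rw [hfdeg k (hin' k (Finset.mem_union_right _ hk))]
    exact hmark k hk
  · intro k hk
    have := hin k hk
    rw [hf k (hin' k hk)]
    simp only [ne_eq, EmbeddingLike.apply_eq_iff_eq, Fin.mk.injEq]
    omega
  · rintro rfl
    have h1 := hlt 1 (by decide)
    have h2 := hlt 2 (by decide)
    rw [hf 1 h1, hf 2 h2]
    exact Insertable.outerOnePlanar (hD1 rfl)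
  · intro h6 _
    refine (hD2 h6).imp (fun H a b c hab hbc hc => ?_) (fun H a b c hab hbc hc => ?_)
    all_goals
      have e1 := H b (by omega) a hab
      have e2 := H c hc b hbc
      rw [hf a (hlt a (by omega)), hf b (hlt b (by omega)), hf c (hlt c hc)]
      simp only [InCyclicOrder, Equiv.symm_apply_apply, Fin.mk_lt_mk]
      omega

theorem found_or_exceptional_boundary (hG : TwoConnected G) (h : IsOuterOnePlane G v) (hn : 4 ≤ n) :
    Found n (boundaryRel G v) 0 (n - 1) (configs (n - 1)) ∨
      Exceptional (boundaryRel G v) 0 (n - 1) := by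
  have := found_or_exceptional (hG.isBoundaryRel h) (n - 1) 0 (by omega) (by omega) (by
    rintro k j - - ⟨-, hj, -⟩
    omega)
  rwa [Nat.zero_add] at this

theorem Exceptional.adj {k : ℕ} (hA : IsBoundaryRel n (boundaryRel G v))
    (h : Exceptional (boundaryRel G v) 0 k) :
    boundaryRel G v 0 1 ∧ boundaryRel G v 0 (k - 1) ∧ boundaryRel G v 1 k ∧
      boundaryRel G v (k - 1) k ∧ (k = 4 → boundaryRel G v 1 2 ∧ boundaryRel G v 2 3) := by
  obtain ⟨m, hm, g, rfl, h⟩ := h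
  have key : ∀ i j, (i, j) ∈ crossEdges 1 m 1 true g true → boundaryRel G v i j := by
    intro i j hij
    have := (h.adj hA (Or.inl hij)).1
    rwa [Nat.zero_add, Nat.zero_add] at this
  have hm' : m = 1 ∨ m = 2 := by simpa using hm
  rcases hm' with rfl | rfl
  · refine ⟨key _ _ ?_, key _ _ ?_, key _ _ ?_, key _ _ ?_, by simp⟩ <;>
      simp [crossEdges, pieceEdges]
  · refine ⟨key _ _ ?_, key _ _ ?_, key _ _ ?_, key _ _ ?_, fun _ => ⟨key _ _ ?_, key _ _ ?_⟩⟩ <;>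
      simp [crossEdges, pieceEdges]

end

/-- The boundary sequence `v₁, …, vₙ` is `v 0, …, v (n - 1)` here. -/
theorem theorem2p3 {V : Type*} [Fintype V] (G : SimpleGraph V) [DecidableRel G.Adj]
    (hG : TwoConnected G) :
    (∀ v : Fin 4 ≃ V, IsOuterOnePlane G v →
      ¬ (G.Adj (v 0) (v 2) ∧ G.Adj (v 1) (v 3) ∧ EdgesCross v (v 0) (v 2) (v 1) (v 3) ∧
          G.Adj (v 0) (v 1) ∧ G.Adj (v 2) (v 3)) →
      ∃ i ∈ ({1, 2} : Finset ℕ), ∃ f : ℕ → V,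
        ProperlyContainsAt G (v 0) (v 3) (picture i) f) ∧
    (∀ v : Fin 5 ≃ V, IsOuterOnePlane G v →
      ¬ ((G.Adj (v 0) (v 1) ∧ G.Adj (v 1) (v 2) ∧ G.Adj (v 2) (v 3) ∧ G.Adj (v 3) (v 4)) ∧
          G.Adj (v 0) (v 3) ∧ G.Adj (v 1) (v 4)) →
      ∃ i ∈ ({1, 2, 3, 4, 6, 8, 13} : Finset ℕ), ∃ f : ℕ → V,
        ProperlyContainsAt G (v 0) (v 4) (picture i) f ∧ PropertyD1 G i f ∧ PropertyD2 v i f) ∧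
    (∀ (n : ℕ) (hn : 6 ≤ n) (v : Fin n ≃ V), IsOuterOnePlane G v →
      ∃ i ∈ Finset.Icc 1 17, ∃ f : ℕ → V,
        ProperlyContainsAt G (v ⟨0, by omega⟩) (v ⟨n - 1, by omega⟩) (picture i) f ∧
          PropertyD1 G i f ∧ PropertyD2 v i f) := by
  refine ⟨fun v hv hex => ?_, fun v hv hex => ?_, fun n hn v hv => ?_⟩
  · rcases found_or_exceptional_boundary hG hv le_rfl with h | h
    · obtain ⟨i, hi, f, hf, -⟩ := h.properlyContains (by omega)
      exact ⟨i, hi, f, hf⟩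
    · obtain ⟨h01, h02, h13, h23, -⟩ := h.adj (hG.isBoundaryRel hv)
      refine (hex ⟨boundaryRel_val.1 h02, boundaryRel_val.1 h13, ?_, boundaryRel_val.1 h01,
        boundaryRel_val.1 h23⟩).elim
      simp only [EdgesCross, Equiv.symm_apply_apply]
      decide
  · rcases found_or_exceptional_boundary hG hv (by omega) with h | h
    · exact h.properlyContains (by omega)
    · obtain ⟨h01, h03, h14, h34, h⟩ := h.adj (hG.isBoundaryRel hv)
      obtain ⟨h12, h23⟩ := h rfl
      exact (hex ⟨⟨boundaryRel_val.1 h01, boundaryRel_val.1 h12, boundaryRel_val.1 h23,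
        boundaryRel_val.1 h34⟩, boundaryRel_val.1 h03, boundaryRel_val.1 h14⟩).elim
  · rcases found_or_exceptional_boundary hG hv (by omega) with h | h
    · obtain ⟨i, hi, h⟩ := h.properlyContains (by omega)
      refine ⟨i, ?_, h⟩
      rwa [configs, if_neg (by omega), if_neg (by omega)] at hi
    -- An exceptional interval has length 3 or 4, but `n - 1 ≥ 5`.
    · obtain ⟨m, hm, -, hk, -⟩ := h
      have : m = 1 ∨ m = 2 := by simpa using hm
      omega
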